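/- Let $G=(V,E)$ be a finite simple graph on $n$ vertices, and let $\mu(\cdot)$ denote the maximum size of a matching. A fractional matching of $G$ is a vector $x\in\mathbb{R}_{\ge 0}^{E}$ with $\sum_{e\ni v}x_e\le 1$ for every $v\in V$; it is $\alpha$-approximate if $\sum_{e\in E} x_e\ge \frac1\alpha\,\mu(G)$. Given a fractional matching $x$, reals $\epsilon\in(0,1)$, $d\ge 1$ and an integer $\gamma\ge 1$, the algorithm Edge-Color and Sparsify does the following. For each $i\in\{1,2,\dots,\lceil 2\log_{1+\epsilon}(n/\epsilon)\rceil\}$ it lets $G_i$ be the subgraph of $G$ formed by the edges $e$ with $x_e\in((1+\epsilon)^{-i},(1+\epsilon)^{-i+1}]$, computes a proper edge coloring $\chi_i$ of $G_i$ with a palette of $\gamma\lceil(1+\epsilon)^i\rceil$ colors, and draws, independently for different $i$, a uniformly random set $S_i$ of $\min\{\gamma\lceil d(1+\epsilon)\rceil,\gamma\lceil(1+\epsilon)^i\rceil\}$ colors of the palette (sampling without replacement). It outputs the random subgraph $H$ of $G$ with vertex set $V$ whose edges are all the edges $e$ of the graphs $G_i$ with $\chi_i(e)\in S_i$. The random graph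 $H$ has approximation ratio $c$ if $\mathbb{E}[\mu(H)]\ge\frac1c\,\mu(G)$. **Lemma.** Let $\epsilon\in(0,1/2)$, $d\ge \frac{4\ln(2/\epsilon)}{\epsilon^2}$, let $\gamma\ge1$ be an integer, and let $x$ be an $\alpha$-approximate fractional matching of $G$ with $0<\alpha\le n/\epsilon$. Then, for every choice of the edge colorings $\chi_i$, the output $H$ of Edge-Color and Sparsify run on $x$ with parameters $\epsilon,d,\gamma$ has approximation ratio $\frac{\alpha}{1-6\epsilon}$ if $G$ is bipartite, that is, $$\mathbb{E}[\mu(H)]\ \ge\ \frac{1-6\epsilon}{\alpha}\,\mu(G),$$ and in general it has approximation ratio $\frac{3\alpha}{2(1-6\epsilon)}$, that is, $$\mathbb{E}[\mu(H)]\ \ge\ \frac{2(1-6\epsilon)}{3\alpha}\,\mu(G).$$ (For $\epsilon\ge 1/6$ the right-hand sides are at most $0$ and the bounds are trivial.) -/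

import Mathlib

namespace EdgeColorSparsify

noncomputable section

open scoped Classical

variable {V : Type*} [Fintype V]

/-- The matching number `μ(G)`: the largest number of edges of a matching in `G`
(for finite `V` the set below is nonempty and bounded, so this is a maximum). -/
def matchingNumber (G : SimpleGraph V) : ℕ :=
  sSup {k | ∃ M : G.Subgraph, M.IsMatching ∧ M.edgeSet.ncard = k}

/-- A fractional matching of `G`: nonnegative edge values whose sum around each vertex is at
most one. Only the values of `x` on the edges of `G` matter. -/
structure IsFractionalMatching (G : SimpleGraph V) (x : Sym2 V → ℝ) : Prop where
  nonneg : ∀ e ∈ G.edgeSet, 0 ≤ x e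
  sum_le_one : ∀ v : V, ∑ e ∈ G.edgeFinset with v ∈ e, x e ≤ 1

/-- An `α`-approximate fractional matching: a fractional matching of value at least
`μ(G) / α`. -/
structure IsApproxFractionalMatching (G : SimpleGraph V) (α : ℝ) (x : Sym2 V → ℝ) : Prop
    extends IsFractionalMatching G x where
  value_ge : (1 / α) * (matchingNumber G : ℝ) ≤ ∑ e ∈ G.edgeFinset, x e

/-- The number `⌈2 log_{1+ε} (n/ε)⌉` of rounds, where `n` is the number of vertices. -/
def numLevels (V : Type*) [Fintype V] (ε : ℝ) : ℕ :=
  ⌈2 * Real.logb (1 + ε) ((Fintype.card V : ℝ) / ε)⌉₊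

/-- The set of rounds `{1, …, ⌈2 log_{1+ε} (n/ε)⌉}`. -/
abbrev Level (V : Type*) [Fintype V] (ε : ℝ) : Type :=
  {i : ℕ // i ∈ Finset.Icc 1 (numLevels V ε)}

/-- The graph `G_i` formed by the edges with `x`-value in `((1+ε)^{-i}, (1+ε)^{-i+1}]`. -/
def levelGraph (G : SimpleGraph V) (x : Sym2 V → ℝ) (ε : ℝ) (i : ℕ) : SimpleGraph V :=
  SimpleGraph.fromEdgeSet
    {e | e ∈ G.edgeSet ∧ (1 + ε) ^ (-(i : ℤ)) < x e ∧ x e ≤ (1 + ε) ^ (-(i : ℤ) + 1)}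

/-- The size `γ ⌈(1+ε)^i⌉` of the palette in round `i`. -/
def numColors (γ : ℕ) (ε : ℝ) (i : ℕ) : ℕ := γ * ⌈(1 + ε) ^ i⌉₊

/-- The number `min {γ ⌈d(1+ε)⌉, γ ⌈(1+ε)^i⌉}` of colors sampled in round `i`. -/
def numSampled (γ : ℕ) (ε d : ℝ) (i : ℕ) : ℕ :=
  min (γ * ⌈d * (1 + ε)⌉₊) (γ * ⌈(1 + ε) ^ i⌉₊)

/-- A choice, for each round `i`, of a proper edge coloring of `G_i` with `γ ⌈(1+ε)^i⌉` colors
(a proper vertex coloring of the line graph of `G_i`). -/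
abbrev LevelColorings (G : SimpleGraph V) (x : Sym2 V → ℝ) (ε : ℝ) (γ : ℕ) :=
  (i : Level V ε) → (levelGraph G x ε i).lineGraph.Coloring (Fin (numColors γ ε i))

/-- A choice of a set of colors in each round. -/
abbrev ColorChoice (V : Type*) [Fintype V] (ε : ℝ) (γ : ℕ) :=
  (i : Level V ε) → Finset (Fin (numColors γ ε i))

/-- The choices with exactly the prescribed number of colors in each round. -/
def admissibleChoices (V : Type*) [Fintype V] (ε d : ℝ) (γ : ℕ) :
    Finset (ColorChoice V ε γ) :=
  Fintype.piFinset fun i : Level V ε =>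
    Finset.powersetCard (numSampled γ ε d i) Finset.univ

theorem admissibleChoices_nonempty (V : Type*) [Fintype V] (ε d : ℝ) (γ : ℕ) :
    (admissibleChoices V ε d γ).Nonempty := by
  rw [admissibleChoices, Fintype.piFinset_nonempty]
  intro i
  rw [Finset.powersetCard_nonempty, Finset.card_univ, Fintype.card_fin]
  exact min_le_right _ _

/-- The law of the sampled colors `(S_i)_i`. The uniform law on the product of the sets of
`numSampled`-element subsets of the palettes: in each round a uniform sample without
replacement, independently in different rounds. -/
def colorSampleLaw (V : Type*) [Fintype V] (ε d : ℝ) (γ : ℕ) : PMF (ColorChoice V ε γ) :=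
  PMF.uniformOfFinset (admissibleChoices V ε d γ) (admissibleChoices_nonempty V ε d γ)

/-- The output graph on the vertex set `V` for the sampled colors `S`: the union of all sampled
color classes. -/
def outputGraph (G : SimpleGraph V) (x : Sym2 V → ℝ) (ε : ℝ) (γ : ℕ)
    (χ : LevelColorings G x ε γ) (S : ColorChoice V ε γ) : SimpleGraph V :=
  SimpleGraph.fromEdgeSet
    {e | ∃ (i : Level V ε) (he : e ∈ (levelGraph G x ε i).edgeSet), χ i ⟨e, he⟩ ∈ S i}

/-- The algorithm "edge-color and sparsify", as the distribution of its random output, when the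
edge colorings that it computes are `χ`. -/
def sparsify (G : SimpleGraph V) (x : Sym2 V → ℝ) (ε d : ℝ) (γ : ℕ)
    (χ : LevelColorings G x ε γ) : PMF (SimpleGraph V) :=
  (colorSampleLaw V ε d γ).map (outputGraph G x ε γ χ)

/-- The expected matching number `E[μ(H)]` of a random graph `H` on `V`. -/
def expectedMatchingNumber (ℋ : PMF (SimpleGraph V)) : ℝ :=
  ∑ H : SimpleGraph V, (ℋ H).toReal * (matchingNumber H : ℝ)

/-- The random graph `ℋ` on the vertex set of `G` consists of subgraphs of `G` and has
approximation ratio `c` (in expectation): `E[μ(H)] ≥ (1/c) μ(G)`. -/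
def HasApproxRatio (G : SimpleGraph V) (ℋ : PMF (SimpleGraph V)) (c : ℝ) : Prop :=
  (∀ H ∈ ℋ.support, H ≤ G) ∧ (1 / c) * (matchingNumber G : ℝ) ≤ expectedMatchingNumber ℋ

end

end EdgeColorSparsify

namespace EdgeColorSparsify

open scoped Classical

/-! ### Matching number, bipartite double cover, and half-integral vertex covers. -/

section Matchings

variable {V : Type*} [Fintype V]

/-! The argument is LP duality against fractional vertex covers of the random output, plus a
second-moment bound in place of concentration.

Every graph `H` has a fractional vertex cover `w` with values in `[0,1]` and total at most `c *
μ(H)`, where `c = 3/2` in general and `c = 1` if `H` is bipartite: König's theorem in the bipartite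
double cover gives a cover and a matching of equal size, and the matching projects to a family of
paths and cycles in `H`, from which a third (bipartite: half) of the arcs can be kept as a matching.

Let `p e` be the probability that `e` survives, and put `y e = x e / p e` if `e ∈ H`, else `0`. Then
`E[∑ y] = ∑ x`, while `∑ y ≤ ∑ v, w v * Y v` with `Y v` the load of `y` at `v`. Edges at a common
vertex are nonpositively correlated (distinct colors in one round, independence across rounds), so
`Y v` has variance at most `2/d` times its mean, which is at most one. Bounding the excess of `Y v`
over `1 + ε` by a multiple of its squared deviation makes the total loss at most `1/(dε)` times `∑
x`; see `sum_le_expect_matchingNumber`. Only `d * ε^2 ≥ 3` is needed.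

Edges below all levels carry at most `3/2 * ε * μ(G)/α`, by `sum_levelEdges_ge`. The losses fit into
`1 - 6ε`. -/

theorem card_edgeSet_le_matchingNumber {H : SimpleGraph V} (M : H.Subgraph)
    (hM : M.IsMatching) : M.edgeSet.ncard ≤ matchingNumber H := by
  refine le_csSup ?_ ⟨M, hM, rfl⟩
  refine ⟨Nat.card (Sym2 V), ?_⟩
  rintro k ⟨N, -, rfl⟩
  exact Set.ncard_le_card _

/-- Two arcs with a common endpoint. -/
def ArcsTouch {V : Type*} (p q : V × V) : Prop :=
  p.1 = q.1 ∨ p.1 = q.2 ∨ p.2 = q.1 ∨ p.2 = q.2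

/-- A family of pairwise vertex-disjoint edges is no larger than the matching number. -/
theorem card_le_matchingNumber {H : SimpleGraph V} (P : Finset (V × V))
    (hadj : ∀ p ∈ P, H.Adj p.1 p.2) (hdisj : ∀ p ∈ P, ∀ q ∈ P, ArcsTouch p q → p = q) :
    P.card ≤ matchingNumber H := by
  let M : H.Subgraph :=
    { verts := {v | ∃ p ∈ P, v = p.1 ∨ v = p.2}
      Adj := fun a b => (a, b) ∈ P ∨ (b, a) ∈ P
      adj_sub := by
        rintro a b (h | h)
        · exact hadj _ h
        · exact (hadj _ h).symm
      edge_vert := by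
        rintro a b (h | h)
        · exact ⟨_, h, Or.inl rfl⟩
        · exact ⟨_, h, Or.inr rfl⟩
      symm := ⟨fun a b h => h.symm⟩ }
  have hM : M.IsMatching := by
    rintro v ⟨⟨a, b⟩, hp, hv⟩
    have key : ∀ y, ((v, y) ∈ P ∨ (y, v) ∈ P) → (v = a ∧ y = b) ∨ (v = b ∧ y = a) := by
      rintro y (h | h)
      · have := hdisj _ h _ hp (by unfold ArcsTouch; rcases hv with rfl | rfl <;> simp)
        simp only [Prod.mk.injEq] at this
        exact Or.inl this
      · have := hdisj _ h _ hp (by unfold ArcsTouch; rcases hv with rfl | rfl <;> simp)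
        simp only [Prod.mk.injEq] at this
        exact Or.inr this.symm
    have hab : a ≠ b := (hadj _ hp).ne
    rcases hv with rfl | rfl
    · refine ⟨b, Or.inl hp, fun y hy => ?_⟩
      rcases key y hy with h | h
      · exact h.2
      · exact absurd h.1 hab
    · refine ⟨a, Or.inr hp, fun y hy => ?_⟩
      rcases key y hy with h | h
      · exact absurd h.1.symm hab
      · exact h.2
  have hcard : P.card ≤ M.edgeSet.ncard := by
    rw [← Set.ncard_coe_finset P]
    refine Set.ncard_le_ncard_of_injOn (fun p => s(p.1, p.2)) ?_ ?_ (Set.toFinite _)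
    · rintro ⟨a, b⟩ h
      exact Or.inl h
    · intro p hp q hq h
      replace h : s(p.1, p.2) = s(q.1, q.2) := h
      refine hdisj p hp q hq ?_
      have : p.1 ∈ s(q.1, q.2) := h ▸ Sym2.mem_mk_left _ _
      rw [Sym2.mem_iff] at this
      unfold ArcsTouch
      tauto
  exact hcard.trans (card_edgeSet_le_matchingNumber M hM)

/-- A family of arcs in which every vertex has out-degree and in-degree at most one. -/
structure IsLinearArcFamily {V : Type*} (H : SimpleGraph V) (P : Finset (V × V)) : Prop where
  adj : ∀ p ∈ P, H.Adj p.1 p.2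
  fst_inj : ∀ p ∈ P, ∀ q ∈ P, p.1 = q.1 → p = q
  snd_inj : ∀ p ∈ P, ∀ q ∈ P, p.2 = q.2 → p = q

/-- In a maximum disjoint subfamily `M`, every arc of `P` touches some `m ∈ M`. An arc touching `m`
is `m` itself, the unique arc leaving its head, or the unique arc entering its tail. A directed
triangle attains the constant 3. -/
theorem IsLinearArcFamily.card_le_three_mul {H : SimpleGraph V} {P : Finset (V × V)}
    (hP : IsLinearArcFamily H P) : P.card ≤ 3 * matchingNumber H := by
  obtain ⟨M, hM, hmax⟩ := Finset.exists_max_image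
    (P.powerset.filter fun M => ∀ p ∈ M, ∀ q ∈ M, ArcsTouch p q → p = q) Finset.card
    ⟨∅, by simp⟩
  rw [Finset.mem_filter, Finset.mem_powerset] at hM
  obtain ⟨hMP, hMd⟩ := hM
  have hself : ∀ p : V × V, ArcsTouch p p := fun p => Or.inl rfl
  have hsymm : ∀ p q : V × V, ArcsTouch p q → ArcsTouch q p := by
    unfold ArcsTouch
    intro p q h
    rcases h with h | h | h | h <;> simp [h]
  have hcover : P ⊆ M.biUnion fun m => P.filter (ArcsTouch m) := by
    intro p hp
    by_contra hcon
    simp only [Finset.mem_biUnion, Finset.mem_filter, not_exists, not_and] at hcon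
    have hpM : p ∉ M := fun h => hcon p h hp (hself p)
    have := hmax (insert p M) (by
      simp only [Finset.mem_filter, Finset.mem_powerset]
      refine ⟨Finset.insert_subset hp hMP, ?_⟩
      intro a ha b hb hab
      rcases Finset.mem_insert.1 ha with ha | ha <;> rcases Finset.mem_insert.1 hb with hb | hb
      · rw [ha, hb]
      · exact absurd (ha ▸ hsymm _ _ hab) (hcon b hb hp)
      · exact absurd (hb ▸ hab) (hcon a ha hp)
      · exact hMd a ha b hb hab)
    rw [Finset.card_insert_of_notMem hpM] at this
    omega
  have hthree : ∀ m ∈ M, (P.filter (ArcsTouch m)).card ≤ 3 := by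
    intro m hm
    have hsub : P.filter (ArcsTouch m) ⊆
        {m} ∪ (P.filter (fun p => p.1 = m.2) ∪ P.filter (fun p => p.2 = m.1)) := by
      intro p hp
      rw [Finset.mem_filter] at hp
      obtain ⟨hp, h | h | h | h⟩ := hp
      · simp [hP.fst_inj m (hMP hm) p hp h]
      · simp [hp, h]
      · simp [hp, h]
      · simp [hP.snd_inj m (hMP hm) p hp h]
    have h1 : (P.filter (fun p => p.1 = m.2)).card ≤ 1 := by
      rw [Finset.card_le_one]
      intro a ha b hb
      rw [Finset.mem_filter] at ha hb
      exact hP.fst_inj a ha.1 b hb.1 (ha.2.trans hb.2.symm)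
    have h2 : (P.filter (fun p => p.2 = m.1)).card ≤ 1 := by
      rw [Finset.card_le_one]
      intro a ha b hb
      rw [Finset.mem_filter] at ha hb
      exact hP.snd_inj a ha.1 b hb.1 (ha.2.trans hb.2.symm)
    have h3 := Finset.card_le_card hsub
    have h4 := Finset.card_union_le {m}
      (P.filter (fun p => p.1 = m.2) ∪ P.filter (fun p => p.2 = m.1))
    have h5 := Finset.card_union_le (P.filter (fun p => p.1 = m.2)) (P.filter (fun p => p.2 = m.1))
    rw [Finset.card_singleton] at h4
    omega
  calc P.card ≤ (M.biUnion fun m => P.filter (ArcsTouch m)).card := Finset.card_le_card hcover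
    _ ≤ M.card * 3 := Finset.card_biUnion_le_card_mul _ _ _ hthree
    _ ≤ 3 * matchingNumber H := by
      have := card_le_matchingNumber M (fun p hp => hP.adj p (hMP hp)) hMd
      omega

/-- The arcs whose tails have a fixed color form a matching: the tail of one and the head of another
have different colors, so two such arcs can meet only tail to tail or head to head. -/
theorem IsLinearArcFamily.card_le_two_mul {H : SimpleGraph V} {P : Finset (V × V)}
    (hP : IsLinearArcFamily H P) (hH : H.IsBipartite) : P.card ≤ 2 * matchingNumber H := by
  obtain ⟨C⟩ : H.Colorable 2 := hH
  have hpart : ∀ c : Fin 2, (P.filter fun p => C p.1 = c).card ≤ matchingNumber H := by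
    intro c
    refine card_le_matchingNumber _ (fun p hp => hP.adj p (Finset.mem_filter.1 hp).1) ?_
    intro p hp q hq h
    rw [Finset.mem_filter] at hp hq
    have hp2 := C.valid (hP.adj p hp.1)
    have hq2 := C.valid (hP.adj q hq.1)
    rcases h with h | h | h | h
    · exact hP.fst_inj p hp.1 q hq.1 h
    · exact absurd (hq.2.trans (hp.2.symm.trans (congrArg C h))) hq2
    · exact absurd (hp.2.trans (hq.2.symm.trans (congrArg C h.symm))) hp2
    · exact hP.snd_inj p hp.1 q hq.1 h
  have hsplit := Finset.card_eq_sum_card_fiberwise (f := fun p : V × V => C p.1) (s := P)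
    (t := Finset.univ) (fun _ _ => Finset.mem_coe.2 (Finset.mem_univ _))
  rw [Fin.sum_univ_two] at hsplit
  have h0 := hpart 0
  have h1 := hpart 1
  omega

/-- `(A, B)` covers every arc of the bipartite double cover of `H`. -/
def IsDoubleCover {V : Type*} (H : SimpleGraph V) (A B : Finset V) : Prop :=
  ∀ u v, H.Adj u v → u ∈ A ∨ v ∈ B

theorem IsDoubleCover.symm {V : Type*} {H : SimpleGraph V} {A B : Finset V} (h : IsDoubleCover H A B) :
    IsDoubleCover H B A := fun u v huv => (h v u huv.symm).symm

/-- Hall's theorem for the neighborhoods outside `B`: if `S ⊆ A` violated Hall's condition,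
replacing `S` by its neighbors outside `B` would give a smaller cover. -/
theorem exists_injective_of_minimal_cover {H : SimpleGraph V} {A B : Finset V}
    (h : IsDoubleCover H A B)
    (hmin : ∀ A' B' : Finset V, IsDoubleCover H A' B' → A.card + B.card ≤ A'.card + B'.card) :
    ∃ f : A → V, Function.Injective f ∧ ∀ a : A, H.Adj a (f a) ∧ f a ∉ B := by
  let t : A → Finset V := fun a => Finset.univ.filter fun v => H.Adj a v ∧ v ∉ B
  obtain ⟨f, hf, hft⟩ := (Finset.all_card_le_biUnion_card_iff_exists_injective t).1 (by
    intro S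
    have hcov : IsDoubleCover H (A \ S.map (Function.Embedding.subtype _)) (B ∪ S.biUnion t) := by
      intro u v huv
      by_cases hv : v ∈ B
      · exact Or.inr (Finset.mem_union_left _ hv)
      rcases h u v huv with hu | hu
      · by_cases hS : (⟨u, hu⟩ : A) ∈ S
        · refine Or.inr (Finset.mem_union_right _ (Finset.mem_biUnion.2 ⟨_, hS, ?_⟩))
          simp [t, huv, hv]
        · refine Or.inl (Finset.mem_sdiff.2 ⟨hu, ?_⟩)
          simpa [hu] using hS
      · exact absurd hu hv
    have h1 := hmin _ _ hcov
    have h2 : S.map (Function.Embedding.subtype _) ⊆ A := by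
      intro a ha
      obtain ⟨b, -, rfl⟩ := Finset.mem_map.1 ha
      exact b.2
    have h3 := Finset.card_sdiff_add_card_eq_card h2
    rw [Finset.card_map] at h3
    have h4 := Finset.card_union_le B (S.biUnion t)
    omega)
  refine ⟨f, hf, fun a => ?_⟩
  have := hft a
  simpa [t] using this

/-- A double cover of `H` and a linear arc family of the same size. -/
theorem exists_doubleCover_arcFamily (H : SimpleGraph V) :
    ∃ (A B : Finset V) (P : Finset (V × V)), IsDoubleCover H A B ∧ IsLinearArcFamily H P ∧
      P.card = A.card + B.card := by
  obtain ⟨⟨A, B⟩, hAB, hmin⟩ := Finset.exists_min_image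
    (Finset.univ.filter fun p : Finset V × Finset V => IsDoubleCover H p.1 p.2)
    (fun p => p.1.card + p.2.card)
    ⟨(Finset.univ, Finset.univ), Finset.mem_filter.2
      ⟨Finset.mem_univ _, fun _ _ _ => Or.inl (Finset.mem_univ _)⟩⟩
  simp only [Finset.mem_filter, Finset.mem_univ, true_and, Prod.forall] at hAB hmin
  obtain ⟨f, hf, hfa⟩ := exists_injective_of_minimal_cover hAB hmin
  obtain ⟨g, hg, hgb⟩ := exists_injective_of_minimal_cover hAB.symm (fun A' B' h => by
    have := hmin B' A' h.symm
    omega)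
  -- Since `f` avoids `B` and `g` avoids `A`, the two arc sets share neither tails nor heads, so
  -- their union is still linear and the sizes add.
  let F : A ↪ V × V := ⟨fun a => (a, f a), fun a b h => Subtype.ext (congrArg Prod.fst h)⟩
  let K : B ↪ V × V := ⟨fun b => (g b, b), fun a b h => Subtype.ext (congrArg Prod.snd h)⟩
  have hmem : ∀ p, p ∈ Finset.univ.map F ∪ Finset.univ.map K ↔
      (∃ a : A, ((a : V), f a) = p) ∨ ∃ b : B, (g b, (b : V)) = p := by
    intro p
    rw [Finset.mem_union, Finset.mem_map, Finset.mem_map]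
    simp only [Finset.mem_univ, true_and]
    rfl
  refine ⟨A, B, Finset.univ.map F ∪ Finset.univ.map K, hAB, ⟨?_, ?_, ?_⟩, ?_⟩
  · intro p hp
    rcases (hmem p).1 hp with ⟨a, rfl⟩ | ⟨b, rfl⟩
    · exact (hfa a).1
    · exact (hgb b).1.symm
  · intro p hp q hq h
    rcases (hmem p).1 hp with ⟨a, rfl⟩ | ⟨b, rfl⟩ <;>
      rcases (hmem q).1 hq with ⟨a', rfl⟩ | ⟨b', rfl⟩ <;> simp only at h
    · rw [Subtype.ext h]
    · exact absurd (h ▸ a.2) (hgb b').2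
    · exact absurd (h ▸ a'.2) (hgb b).2
    · rw [hg h]
  · intro p hp q hq h
    rcases (hmem p).1 hp with ⟨a, rfl⟩ | ⟨b, rfl⟩ <;>
      rcases (hmem q).1 hq with ⟨a', rfl⟩ | ⟨b', rfl⟩ <;> simp only at h
    · rw [hf h]
    · exact absurd (h ▸ b'.2) (hfa a).2
    · exact absurd (h ▸ b.2) (hfa a').2
    · rw [Subtype.ext h]
  · rw [Finset.card_union_of_disjoint, Finset.card_map, Finset.card_map]
    · simp
    · rw [Finset.disjoint_left]
      intro p hp hq
      obtain ⟨a, -, rfl⟩ := Finset.mem_map.1 hp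
      obtain ⟨b, -, h⟩ := Finset.mem_map.1 hq
      have : g b = a := congrArg Prod.fst h
      exact (hgb b).2 (this ▸ a.2)

/-- A fractional vertex cover of `H`. -/
structure IsFractionalCover {V : Type*} (H : SimpleGraph V) (w : V → ℝ) : Prop where
  nonneg : ∀ v, 0 ≤ w v
  le_one : ∀ v, w v ≤ 1
  cover : ∀ u v, H.Adj u v → 1 ≤ w u + w v

theorem exists_fractionalCover_arcFamily (H : SimpleGraph V) :
    ∃ (w : V → ℝ) (P : Finset (V × V)), IsFractionalCover H w ∧ IsLinearArcFamily H P ∧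
      ∑ v, w v = (P.card : ℝ) / 2 := by
  obtain ⟨A, B, P, hAB, hP, hcard⟩ := exists_doubleCover_arcFamily H
  -- Averaging the two sides works because both orientations of each edge are covered, each
  -- contributing one half.
  refine ⟨fun v => ((if v ∈ A then 1 else 0) + if v ∈ B then 1 else 0) / 2, P,
    ⟨fun v => ?_, fun v => ?_, fun u v h => ?_⟩, hP, ?_⟩
  · positivity
  · split_ifs <;> norm_num
  · have h1 := hAB u v h
    have h2 := hAB v u h.symm
    rcases h1 with h1 | h1 <;> rcases h2 with h2 | h2 <;> simp only [h1, h2, if_true] <;>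
      split_ifs <;> norm_num
  · rw [← Finset.sum_div, Finset.sum_add_distrib, hcard]
    simp

theorem exists_fractionalCover (H : SimpleGraph V) :
    ∃ w : V → ℝ, IsFractionalCover H w ∧ ∑ v, w v ≤ 3 / 2 * (matchingNumber H : ℝ) := by
  obtain ⟨w, P, hw, hP, hsum⟩ := exists_fractionalCover_arcFamily H
  refine ⟨w, hw, ?_⟩
  have : (P.card : ℝ) ≤ 3 * matchingNumber H := by exact_mod_cast hP.card_le_three_mul
  rw [hsum]
  linarith

theorem exists_fractionalCover_of_isBipartite {H : SimpleGraph V} (hH : H.IsBipartite) :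
    ∃ w : V → ℝ, IsFractionalCover H w ∧ ∑ v, w v ≤ 1 * (matchingNumber H : ℝ) := by
  obtain ⟨w, P, hw, hP, hsum⟩ := exists_fractionalCover_arcFamily H
  refine ⟨w, hw, ?_⟩
  have : (P.card : ℝ) ≤ 2 * matchingNumber H := by exact_mod_cast hP.card_le_two_mul hH
  rw [hsum]
  linarith

/-- A fractional cover bounds the value of any nonnegative edge weighting. -/
theorem IsFractionalCover.sum_le {H : SimpleGraph V} {w : V → ℝ} (hw : IsFractionalCover H w)
    (E : Finset (Sym2 V)) (y : Sym2 V → ℝ) (hy : ∀ e ∈ E, 0 ≤ y e)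
    (hE : ∀ e ∈ E, y e ≠ 0 → e ∈ H.edgeSet) :
    ∑ e ∈ E, y e ≤ ∑ v, w v * ∑ e ∈ E with v ∈ e, y e := by
  have hswap : ∑ v, w v * ∑ e ∈ E with v ∈ e, y e =
      ∑ e ∈ E, (∑ v with v ∈ e, w v) * y e := by
    simp_rw [Finset.mul_sum, Finset.sum_mul, Finset.sum_filter]
    exact Finset.sum_comm
  rw [hswap]
  refine Finset.sum_le_sum fun e he => ?_
  by_cases h0 : y e = 0
  · simp [h0]
  have heH := hE e he h0
  refine le_mul_of_one_le_left (hy e he) ?_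
  induction e with
  | h a b =>
    have hab : H.Adj a b := heH
    have hfil : (Finset.univ.filter fun v => v ∈ s(a, b)) = {a, b} := by
      ext v
      simp
    rw [hfil, Finset.sum_pair hab.ne]
    exact hw.cover a b hab

/-- The number of edges is at most `3/2 * n * μ(G)`. -/
theorem card_edgeFinset_le (G : SimpleGraph V) :
    (G.edgeFinset.card : ℝ) ≤ 3 / 2 * (Fintype.card V * matchingNumber G) := by
  obtain ⟨w, hw, hsum⟩ := exists_fractionalCover G
  have h := hw.sum_le G.edgeFinset (fun _ => 1) (fun _ _ => zero_le_one)
    (fun e he _ => by simpa using he)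
  have hdeg : ∀ v, (∑ e ∈ G.edgeFinset with v ∈ e, (1 : ℝ)) ≤ Fintype.card V := by
    intro v
    rw [Finset.sum_const, nsmul_eq_mul, mul_one]
    have hsub : G.edgeFinset.filter (fun e => v ∈ e) ⊆ Finset.univ.image (fun u => s(v, u)) := by
      intro e he
      obtain ⟨u, rfl⟩ := (Finset.mem_filter.1 he).2
      exact Finset.mem_image_of_mem _ (Finset.mem_univ _)
    exact_mod_cast (Finset.card_le_card hsub).trans Finset.card_image_le
  calc (G.edgeFinset.card : ℝ) = ∑ e ∈ G.edgeFinset, (1 : ℝ) := by simp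
    _ ≤ ∑ v, w v * (Fintype.card V : ℝ) :=
      h.trans (Finset.sum_le_sum fun v _ => mul_le_mul_of_nonneg_left (hdeg v) (hw.nonneg v))
    _ = (Fintype.card V : ℝ) * ∑ v, w v := by rw [← Finset.sum_mul, mul_comm]
    _ ≤ (Fintype.card V : ℝ) * (3 / 2 * matchingNumber G) := by gcongr
    _ = _ := by ring

end Matchings

/-! ### Independence across rounds and sampling without replacement. -/

section Sampling

open Finset BigOperators

theorem expect_piFinset_prod {ι : Type*} [Fintype ι] [DecidableEq ι] {κ : ι → Type*}
    (t : (i : ι) → Finset (κ i)) (f : (i : ι) → κ i → ℝ) :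
    𝔼 S ∈ Fintype.piFinset t, ∏ i, f i (S i) = ∏ i, 𝔼 a ∈ t i, f i a := by
  simp_rw [expect_eq_sum_div_card, prod_div_distrib, prod_univ_sum, Fintype.card_piFinset]
  push_cast
  rfl

theorem expect_piFinset_apply {ι : Type*} [Fintype ι] [DecidableEq ι] {κ : ι → Type*}
    (t : (i : ι) → Finset (κ i)) (ht : ∀ i, (t i).Nonempty) (i : ι) (g : κ i → ℝ) :
    𝔼 S ∈ Fintype.piFinset t, g (S i) = 𝔼 a ∈ t i, g a := by
  have h := expect_piFinset_prod t (Function.update (fun _ _ => 1) i g)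
  rw [Fintype.prod_eq_single i] at h
  · rw [Function.update_self] at h
    rw [← h]
    refine expect_congr rfl fun S _ => ?_
    rw [Fintype.prod_eq_single i]
    · rw [Function.update_self]
    · intro j hj
      rw [Function.update_of_ne hj]
  · intro j hj
    rw [Function.update_of_ne hj, expect_const (ht j)]

theorem expect_piFinset_mul {ι : Type*} [Fintype ι] [DecidableEq ι] {κ : ι → Type*}
    (t : (i : ι) → Finset (κ i)) (ht : ∀ i, (t i).Nonempty) {i j : ι} (hij : i ≠ j)
    (g : κ i → ℝ) (h : κ j → ℝ) :
    𝔼 S ∈ Fintype.piFinset t, g (S i) * h (S j) = (𝔼 a ∈ t i, g a) * 𝔼 a ∈ t j, h a := by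
  have hp := expect_piFinset_prod t
    (Function.update (Function.update (fun _ _ => 1) i g) j h)
  have hne : ∀ k, k ≠ i ∧ k ≠ j →
      Function.update (Function.update (fun _ _ => (1 : ℝ)) i g) j h k = fun _ => 1 := by
    intro k hk
    rw [Function.update_of_ne hk.2, Function.update_of_ne hk.1]
  rw [Fintype.prod_eq_mul i j hij] at hp
  · rw [Function.update_self, Function.update_of_ne hij, Function.update_self] at hp
    rw [← hp]
    refine expect_congr rfl fun S _ => ?_
    rw [Fintype.prod_eq_mul i j hij]
    · rw [Function.update_self, Function.update_of_ne hij, Function.update_self]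
    · intro k hk
      rw [hne k hk]
  · intro k hk
    rw [hne k hk, expect_const (ht k)]

/-- The probability that a uniform `k`-subset of `Fin N` contains `T`. -/
theorem expect_powersetCard_subset {N k : ℕ} (hk : k ≤ N) (T : Finset (Fin N)) (hT : #T ≤ k) :
    𝔼 S ∈ powersetCard k (univ : Finset (Fin N)), (if T ⊆ S then (1 : ℝ) else 0) =
      (k.choose #T : ℝ) / N.choose #T := by
  rw [expect_eq_sum_div_card, sum_boole, card_filter_powersetCard_subset _ _ _ (subset_univ _) hT,
    card_powersetCard, card_univ, Fintype.card_fin]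
  have h := Nat.choose_mul (n := N) hT
  have h1 : (0 : ℝ) < N.choose k := by exact_mod_cast Nat.choose_pos hk
  have h2 : (0 : ℝ) < N.choose #T := by exact_mod_cast Nat.choose_pos (hT.trans hk)
  rw [div_eq_div_iff h1.ne' h2.ne']
  have h3 : (N.choose k : ℝ) * k.choose #T = N.choose #T * (N - #T).choose (k - #T) := by
    exact_mod_cast h
  linarith

theorem expect_powersetCard_mem {N k : ℕ} (hk : k ≤ N) (hk0 : 1 ≤ k) (c : Fin N) :
    𝔼 S ∈ powersetCard k (univ : Finset (Fin N)), (if c ∈ S then (1 : ℝ) else 0) = k / N := by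
  have h := expect_powersetCard_subset hk {c} (by simpa using hk0)
  simpa using h

/-- Sampling without replacement is negatively correlated: `k(k-1)/(N(N-1)) ≤ (k/N)^2` because `k ≤
N`; for `k ≤ 1` two distinct colors never occur together. -/
theorem expect_powersetCard_mem_mul_mem_le {N k : ℕ} (hk : k ≤ N) {c c' : Fin N}
    (hc : c ≠ c') :
    𝔼 S ∈ powersetCard k (univ : Finset (Fin N)),
      (if c ∈ S then (1 : ℝ) else 0) * (if c' ∈ S then (1 : ℝ) else 0) ≤
        ((k : ℝ) / N) * (k / N) := by
  have hcard : #({c, c'} : Finset (Fin N)) = 2 := card_pair hc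
  have heq : ∀ S : Finset (Fin N),
      (if c ∈ S then (1 : ℝ) else 0) * (if c' ∈ S then (1 : ℝ) else 0) =
        if {c, c'} ⊆ S then 1 else 0 := by
    intro S
    simp only [insert_subset_iff, singleton_subset_iff]
    by_cases h : c ∈ S <;> by_cases h' : c' ∈ S <;> simp [h, h']
  simp_rw [heq]
  by_cases hk2 : 2 ≤ k
  · rw [expect_powersetCard_subset hk _ (hcard ▸ hk2), hcard, Nat.cast_choose_two,
      Nat.cast_choose_two]
    have h2 : (2 : ℝ) ≤ k := by exact_mod_cast hk2
    have hN : (k : ℝ) ≤ N := by exact_mod_cast hk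
    rw [← mul_div_mul_comm, div_le_div_iff₀ (by nlinarith) (by nlinarith)]
    have : (k : ℝ) * N * (k - 1) * N ≤ k * N * k * (N - 1) := by
      have h3 : (0 : ℝ) ≤ k * N := by nlinarith
      nlinarith
    nlinarith
  · rw [expect_eq_zero]
    · positivity
    · intro S hS
      rw [if_neg]
      intro hsub
      have := card_le_card hsub
      rw [hcard, (mem_powersetCard.1 hS).2] at this
      exact hk2 this

end Sampling

/-! ### Second moments of reweighted indicators. -/

section Variance

open Finset BigOperators

/-- A sum of pairwise nonpositively correlated centered variables has variance at most the sum of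
the variances. -/
theorem expect_sq_sum_le {Ω ι : Type*} (O : Finset Ω) (E : Finset ι) (Z : ι → Ω → ℝ)
    (h : ∀ e ∈ E, ∀ f ∈ E, e ≠ f → 𝔼 S ∈ O, Z e S * Z f S ≤ 0) :
    𝔼 S ∈ O, (∑ e ∈ E, Z e S) ^ 2 ≤ ∑ e ∈ E, 𝔼 S ∈ O, Z e S ^ 2 := by
  simp_rw [sq, sum_mul_sum]
  rw [expect_sum_comm]
  refine sum_le_sum fun e he => ?_
  rw [expect_sum_comm]
  refine (sum_le_sum (g := fun f => if f = e then 𝔼 S ∈ O, Z e S * Z e S else 0) ?_).trans ?_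
  · intro f hf
    by_cases hfe : f = e
    · rw [if_pos hfe, hfe]
    · rw [if_neg hfe]
      exact h e he f hf (Ne.symm hfe)
  · rw [sum_ite_eq' E e, if_pos he]

/-- Reweighted indicators of pairwise nonpositively correlated events. -/
theorem expect_centered_mul_le {Ω : Type*} {O : Finset Ω} (hO : O.Nonempty) {I J : Ω → ℝ}
    {p q : ℝ} (hp : 0 < p) (hq : 0 < q) (hI : 𝔼 S ∈ O, I S = p) (hJ : 𝔼 S ∈ O, J S = q)
    (hIJ : 𝔼 S ∈ O, I S * J S ≤ p * q) {a b : ℝ} (ha : 0 ≤ a) (hb : 0 ≤ b) :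
    𝔼 S ∈ O, (a / p * I S - a) * (b / q * J S - b) ≤ 0 := by
  have h : ∀ S, (a / p * I S - a) * (b / q * J S - b) =
      (a / p * (b / q)) * (I S * J S) - (a / p * b) * I S - (a * (b / q)) * J S + a * b := by
    intro S
    ring
  simp_rw [h]
  rw [expect_add_distrib, expect_sub_distrib, expect_sub_distrib, ← mul_expect, ← mul_expect,
    ← mul_expect, hI, hJ, expect_const hO]
  have h1 : a / p * (b / q) * 𝔼 S ∈ O, I S * J S ≤ a / p * (b / q) * (p * q) := by gcongr
  have h2 : a / p * (b / q) * (p * q) = a * b := by field_simp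
  have h3 : a / p * b * p = a * b := by field_simp
  have h4 : a * (b / q) * q = a * b := by field_simp
  linarith

theorem expect_centered_sq {Ω : Type*} {O : Finset Ω} (hO : O.Nonempty) {I : Ω → ℝ}
    {p : ℝ} (hp : 0 < p) (hI : 𝔼 S ∈ O, I S = p) (hI2 : ∀ S, I S * I S = I S) (a : ℝ) :
    𝔼 S ∈ O, (a / p * I S - a) ^ 2 = a ^ 2 / p - a ^ 2 := by
  have h : ∀ S, (a / p * I S - a) ^ 2 = ((a / p) ^ 2 - 2 * (a / p * a)) * I S + a ^ 2 := by
    intro S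
    linear_combination (a / p) ^ 2 * hI2 S
  simp_rw [h]
  rw [expect_add_distrib, ← mul_expect, hI, expect_const hO]
  field_simp
  ring

end Variance

/-! ### From vertex covers and variances to the expected matching number. -/

section Covering

open Finset BigOperators

variable {V : Type*} [Fintype V]

theorem sum_sum_mem_le (E : Finset (Sym2 V)) (y : Sym2 V → ℝ) (hy : ∀ e ∈ E, 0 ≤ y e) :
    ∑ v : V, ∑ e ∈ E with v ∈ e, y e ≤ 2 * ∑ e ∈ E, y e := by
  simp_rw [sum_filter]
  rw [sum_comm, mul_sum]
  refine sum_le_sum fun e he => ?_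
  rw [← sum_filter, sum_const, nsmul_eq_mul]
  refine mul_le_mul_of_nonneg_right ?_ (hy e he)
  have hfil : (univ.filter fun v => v ∈ e) = e.toFinset := by
    ext v
    simp
  rw [hfil, Sym2.card_toFinset]
  split_ifs <;> norm_num

/-- If each edge `e` of a fractional matching `x` is present in a random graph `H` with
probability `p e`, if edges at a common vertex are nonpositively correlated, and if the
reweighted values `x e / p e` are small for the uncertain edges, then the expected matching
number of `H` is almost the value of `x`, up to the integrality gap `c` of fractional covers. -/
theorem sum_le_expect_matchingNumber {Ω : Type*} {O : Finset Ω} (hO : O.Nonempty)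
    (H : Ω → SimpleGraph V) (E : Finset (Sym2 V)) (x p : Sym2 V → ℝ) {b c δ : ℝ} (hδ : 0 < δ)
    (hx : ∀ e ∈ E, 0 ≤ x e) (hx1 : ∀ v, ∑ e ∈ E with v ∈ e, x e ≤ 1)
    (hp : ∀ e ∈ E, 0 < p e)
    (hI : ∀ e ∈ E, 𝔼 S ∈ O, (if e ∈ (H S).edgeSet then (1 : ℝ) else 0) = p e)
    (hcorr : ∀ e ∈ E, ∀ f ∈ E, e ≠ f → ∀ v, v ∈ e → v ∈ f →
      𝔼 S ∈ O, (if e ∈ (H S).edgeSet then (1 : ℝ) else 0) *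
        (if f ∈ (H S).edgeSet then (1 : ℝ) else 0) ≤ p e * p f)
    (hvar : ∀ e ∈ E, x e ^ 2 / p e - x e ^ 2 ≤ b * x e)
    (hcov : ∀ S ∈ O, ∃ w : V → ℝ, IsFractionalCover (H S) w ∧
      ∑ v, w v ≤ c * (matchingNumber (H S) : ℝ)) (hb : 0 ≤ b) :
    (1 - b / (2 * δ)) * ∑ e ∈ E, x e ≤
      (1 + δ) * (c * 𝔼 S ∈ O, (matchingNumber (H S) : ℝ)) := by
  set I : Sym2 V → Ω → ℝ := fun e S => if e ∈ (H S).edgeSet then 1 else 0 with hIdef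
  set y : Sym2 V → Ω → ℝ := fun e S => x e / p e * I e S with hydef
  have hpoint : ∀ S ∈ O, ∑ e ∈ E, y e S ≤ (1 + δ) * (c * (matchingNumber (H S) : ℝ)) +
      ∑ v, (∑ e ∈ E with v ∈ e, (y e S - x e)) ^ 2 / (4 * δ) := by
    intro S hS
    obtain ⟨w, hw, hwsum⟩ := hcov S hS
    have hI0 : ∀ e, 0 ≤ I e S := fun e => by
      simp only [hIdef]
      split_ifs <;> norm_num
    have h1 := hw.sum_le E (fun e => y e S)
      (fun e he => mul_nonneg (div_nonneg (hx e he) (hp e he).le) (hI0 e))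
      (fun e he h => by
        by_contra hcon
        exact h (by simp [hydef, hIdef, hcon]))
    refine h1.trans ?_
    have h2 : ∀ v, w v * ∑ e ∈ E with v ∈ e, y e S ≤
        w v * (1 + δ) + (∑ e ∈ E with v ∈ e, (y e S - x e)) ^ 2 / (4 * δ) := by
      intro v
      rw [sum_sub_distrib]
      set Y := ∑ e ∈ E with v ∈ e, y e S
      set m := ∑ e ∈ E with v ∈ e, x e
      have hm : m ≤ 1 := hx1 v
      -- This is `(Y - m - 2δ)^2 ≥ 0` rearranged; it replaces a tail bound for the excess load by
      -- the variance.
      have hq : (Y - m) - δ ≤ (Y - m) ^ 2 / (4 * δ) := by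
        rw [le_div_iff₀ (by positivity)]
        nlinarith [sq_nonneg (Y - m - 2 * δ)]
      have hq0 : 0 ≤ (Y - m) ^ 2 / (4 * δ) := by positivity
      have h3 : w v * (Y - (1 + δ)) ≤ w v * ((Y - m) ^ 2 / (4 * δ)) :=
        mul_le_mul_of_nonneg_left (by linarith) (hw.nonneg v)
      have h4 : w v * ((Y - m) ^ 2 / (4 * δ)) ≤ (Y - m) ^ 2 / (4 * δ) :=
        mul_le_of_le_one_left hq0 (hw.le_one v)
      linarith
    refine (sum_le_sum fun v _ => h2 v).trans ?_
    rw [sum_add_distrib, ← sum_mul]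
    nlinarith [mul_le_mul_of_nonneg_right hwsum (by linarith : (0 : ℝ) ≤ 1 + δ)]
  have hmean : 𝔼 S ∈ O, ∑ e ∈ E, y e S = ∑ e ∈ E, x e := by
    rw [expect_sum_comm]
    refine sum_congr rfl fun e he => ?_
    rw [← mul_expect, hI e he, div_mul_cancel₀ _ (hp e he).ne']
  have hvarv : ∀ v, 𝔼 S ∈ O, (∑ e ∈ E with v ∈ e, (y e S - x e)) ^ 2 ≤
      b * ∑ e ∈ E with v ∈ e, x e := by
    intro v
    refine (expect_sq_sum_le O _ (fun e S => y e S - x e) ?_).trans ?_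
    · intro e he f hf hef
      rw [mem_filter] at he hf
      exact expect_centered_mul_le hO (hp e he.1) (hp f hf.1) (hI e he.1) (hI f hf.1)
        (hcorr e he.1 f hf.1 hef v he.2 hf.2) (hx e he.1) (hx f hf.1)
    · rw [mul_sum]
      refine sum_le_sum fun e he => ?_
      have he' := (mem_filter.1 he).1
      rw [expect_centered_sq hO (hp e he') (hI e he') (fun S => by
        split_ifs <;> norm_num)]
      exact hvar e he'
  have hexp := expect_le_expect hpoint
  rw [hmean, expect_add_distrib, ← mul_expect, ← mul_expect, expect_sum_comm] at hexp
  -- Each edge is counted at no more than two vertices, which turns `b / (4δ)` into `b / (2δ)`.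
  have hlast : ∑ v, 𝔼 S ∈ O, (∑ e ∈ E with v ∈ e, (y e S - x e)) ^ 2 / (4 * δ) ≤
      b / (2 * δ) * ∑ e ∈ E, x e := by
    simp_rw [← expect_div]
    rw [← sum_div, div_le_iff₀ (by positivity)]
    calc ∑ v, 𝔼 S ∈ O, (∑ e ∈ E with v ∈ e, (y e S - x e)) ^ 2
        ≤ ∑ v, b * ∑ e ∈ E with v ∈ e, x e := sum_le_sum fun v _ => hvarv v
      _ = b * ∑ v, ∑ e ∈ E with v ∈ e, x e := by rw [mul_sum]
      _ ≤ b * (2 * ∑ e ∈ E, x e) := mul_le_mul_of_nonneg_left (sum_sum_mem_le E x hx) hb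
      _ = _ := by
        field_simp
        ring
  linarith

end Covering

/-! ### The output law and the decomposition of edges into levels. -/

section Output

open Finset BigOperators

variable {V : Type*} [Fintype V]

theorem expectedMatchingNumber_sparsify (G : SimpleGraph V) (x : Sym2 V → ℝ) (ε d : ℝ) (γ : ℕ)
    (χ : LevelColorings G x ε γ) :
    expectedMatchingNumber (sparsify G x ε d γ χ) =
      𝔼 S ∈ admissibleChoices V ε d γ, (matchingNumber (outputGraph G x ε γ χ S) : ℝ) := by
  have hval : ∀ H, ((sparsify G x ε d γ χ) H).toReal =
      ∑ S ∈ admissibleChoices V ε d γ, if H = outputGraph G x ε γ χ S then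
        ((#(admissibleChoices V ε d γ) : ℝ))⁻¹ else 0 := by
    intro H
    rw [sparsify, PMF.map_apply, tsum_fintype, ENNReal.toReal_sum]
    · rw [← sum_subset (subset_univ (admissibleChoices V ε d γ))]
      · refine sum_congr rfl fun S hS => ?_
        rw [colorSampleLaw, PMF.uniformOfFinset_apply_of_mem _ hS]
        split_ifs <;> simp
      · intro S _ hS
        rw [colorSampleLaw, PMF.uniformOfFinset_apply_of_notMem _ hS]
        simp
    · intro S _
      split_ifs
      · exact PMF.apply_ne_top _ _
      · simp
  rw [expectedMatchingNumber, expect_eq_sum_div_card]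
  simp_rw [hval, sum_mul]
  rw [sum_comm, sum_div]
  refine sum_congr rfl fun S _ => ?_
  simp_rw [ite_mul, zero_mul]
  rw [sum_ite_eq' univ (outputGraph G x ε γ χ S), if_pos (mem_univ _), div_eq_inv_mul]

theorem mem_levelGraph_iff {V : Type*} {G : SimpleGraph V} {x : Sym2 V → ℝ} {ε : ℝ} {i : ℕ} {e : Sym2 V} :
    e ∈ (levelGraph G x ε i).edgeSet ↔
      e ∈ G.edgeSet ∧ (1 + ε) ^ (-(i : ℤ)) < x e ∧ x e ≤ (1 + ε) ^ (-(i : ℤ) + 1) := by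
  rw [levelGraph, SimpleGraph.edgeSet_fromEdgeSet, Set.mem_sdiff]
  exact ⟨fun h => h.1, fun h => ⟨h, fun hd => G.not_isDiag_of_mem_edgeSet h.1 hd⟩⟩

theorem outputGraph_le (G : SimpleGraph V) (x : Sym2 V → ℝ) (ε : ℝ) (γ : ℕ)
    (χ : LevelColorings G x ε γ) (S : ColorChoice V ε γ) : outputGraph G x ε γ χ S ≤ G := by
  rw [← SimpleGraph.edgeSet_subset_edgeSet]
  intro e he
  rw [outputGraph, SimpleGraph.edgeSet_fromEdgeSet] at he
  obtain ⟨⟨i, hi, -⟩, -⟩ := he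
  exact (mem_levelGraph_iff.1 hi).1

theorem level_unique {V : Type*} {G : SimpleGraph V} {x : Sym2 V → ℝ} {ε : ℝ} (hε : 0 < ε) {i j : ℕ}
    {e : Sym2 V} (hi : e ∈ (levelGraph G x ε i).edgeSet)
    (hj : e ∈ (levelGraph G x ε j).edgeSet) : i = j := by
  have key : ∀ {i j : ℕ}, e ∈ (levelGraph G x ε i).edgeSet →
      e ∈ (levelGraph G x ε j).edgeSet → ¬ i < j := by
    intro i j hi hj hij
    have h1 := (mem_levelGraph_iff.1 hi).2.1
    have h2 := (mem_levelGraph_iff.1 hj).2.2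
    have h3 : (1 + ε) ^ (-(j : ℤ) + 1) ≤ (1 + ε) ^ (-(i : ℤ)) :=
      zpow_le_zpow_right₀ (by linarith) (by omega)
    linarith
  have h1 := key hi hj
  have h2 := key hj hi
  omega

theorem mem_outputGraph_iff {G : SimpleGraph V} {x : Sym2 V → ℝ} {ε : ℝ} (hε : 0 < ε) {γ : ℕ}
    (χ : LevelColorings G x ε γ) (S : ColorChoice V ε γ) (i : Level V ε) {e : Sym2 V}
    (he : e ∈ (levelGraph G x ε i).edgeSet) :
    e ∈ (outputGraph G x ε γ χ S).edgeSet ↔ χ i ⟨e, he⟩ ∈ S i := by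
  rw [outputGraph, SimpleGraph.edgeSet_fromEdgeSet, Set.mem_sdiff]
  constructor
  · rintro ⟨⟨j, hj, h⟩, -⟩
    obtain rfl : i = j := Subtype.ext (level_unique hε he hj)
    exact h
  · exact fun h => ⟨⟨i, he, h⟩, fun hd => SimpleGraph.not_isDiag_of_mem_edgeSet _ he hd⟩

theorem exists_level {G : SimpleGraph V} {x : Sym2 V → ℝ} {ε : ℝ} (hε : 0 < ε) {e : Sym2 V}
    (he : e ∈ G.edgeSet) (hx1 : x e ≤ 1) (hx : (1 + ε) ^ (-(numLevels V ε : ℤ)) < x e) :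
    ∃ i : Level V ε, e ∈ (levelGraph G x ε i).edgeSet := by
  have h1 : (1 : ℝ) < 1 + ε := by linarith
  have hx0 : 0 < x e := (zpow_pos (by linarith) _).trans hx
  obtain ⟨n, hn⟩ := exists_mem_Ioc_zpow hx0 h1
  -- Level numbers start at 1 because `x e ≤ 1` and the intervals are open on the left.
  have hn0 : n < 0 := by
    have : (1 + ε) ^ n < (1 + ε) ^ (0 : ℤ) := by
      rw [zpow_zero]
      exact hn.1.trans_le hx1
    exact (zpow_lt_zpow_iff_right₀ h1).1 this
  have hnL : -(numLevels V ε : ℤ) < n + 1 :=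
    (zpow_lt_zpow_iff_right₀ h1).1 (hx.trans_le hn.2)
  obtain ⟨i, rfl⟩ : ∃ i : ℕ, n = -(i : ℤ) := ⟨n.natAbs, by omega⟩
  refine ⟨⟨i, ?_⟩, mem_levelGraph_iff.2 ⟨he, hn.1, hn.2⟩⟩
  rw [mem_Icc]
  omega

theorem zpow_neg_numLevels_le {ε : ℝ} (hε : 0 < ε) (hV : 0 < Fintype.card V) :
    (1 + ε) ^ (-(numLevels V ε : ℤ)) ≤ (ε / Fintype.card V) ^ 2 := by
  have hn : (0 : ℝ) < Fintype.card V := by exact_mod_cast hV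
  have h1 : (1 : ℝ) < 1 + ε := by linarith
  have hq : (0 : ℝ) < Fintype.card V / ε := by positivity
  have hle : (Fintype.card V / ε) ^ 2 ≤ (1 + ε) ^ (numLevels V ε) := by
    have hceil : 2 * Real.logb (1 + ε) (Fintype.card V / ε) ≤ (numLevels V ε : ℝ) := Nat.le_ceil _
    have : Real.logb (1 + ε) ((Fintype.card V / ε) ^ 2) ≤ (numLevels V ε : ℝ) := by
      rw [Real.logb_pow]
      exact_mod_cast hceil
    rw [Real.logb_le_iff_le_rpow h1 (by positivity), Real.rpow_natCast] at this
    exact this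
  rw [zpow_neg, zpow_natCast, ← inv_div, inv_pow]
  exact inv_anti₀ (by positivity) hle

end Output

/-! ### Survival probabilities and correlations of edges. -/

section Probabilities

open Finset BigOperators

variable {V : Type*} [Fintype V]

theorem numSampled_le (γ : ℕ) (ε d : ℝ) (i : ℕ) : numSampled γ ε d i ≤ numColors γ ε i :=
  min_le_right _ _

theorem one_le_numSampled {γ : ℕ} {ε d : ℝ} (hε : 0 < ε) (hd : 0 < d) (hγ : 1 ≤ γ) (i : ℕ) :
    1 ≤ numSampled γ ε d i := by
  refine le_min (Nat.mul_pos hγ (Nat.ceil_pos.2 ?_)) (Nat.mul_pos hγ (Nat.ceil_pos.2 ?_)) <;>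
    positivity

theorem expect_mem_outputGraph {G : SimpleGraph V} {x : Sym2 V → ℝ} {ε d : ℝ} (hε : 0 < ε)
    (hd : 0 < d) {γ : ℕ} (hγ : 1 ≤ γ) (χ : LevelColorings G x ε γ) (i : Level V ε) {e : Sym2 V}
    (he : e ∈ (levelGraph G x ε i).edgeSet) :
    𝔼 S ∈ admissibleChoices V ε d γ,
      (if e ∈ (outputGraph G x ε γ χ S).edgeSet then (1 : ℝ) else 0) =
        numSampled γ ε d i / numColors γ ε i := by
  have hind : ∀ S, (if e ∈ (outputGraph G x ε γ χ S).edgeSet then (1 : ℝ) else 0) =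
      if χ i ⟨e, he⟩ ∈ S i then 1 else 0 := fun S => by
    simp only [mem_outputGraph_iff hε χ S i he]
  simp_rw [hind]
  rw [admissibleChoices, expect_piFinset_apply _ (fun j => ?_) i
    (fun T => if χ i ⟨e, he⟩ ∈ T then (1 : ℝ) else 0)]
  · exact expect_powersetCard_mem (numSampled_le _ _ _ _) (one_le_numSampled hε hd hγ _) _
  · rw [powersetCard_nonempty, card_univ, Fintype.card_fin]
    exact numSampled_le _ _ _ _

theorem expect_mem_mul_mem_outputGraph_le {G : SimpleGraph V} {x : Sym2 V → ℝ} {ε d : ℝ}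
    (hε : 0 < ε) (hd : 0 < d) {γ : ℕ} (hγ : 1 ≤ γ) (χ : LevelColorings G x ε γ) (i j : Level V ε)
    {e f : Sym2 V} (he : e ∈ (levelGraph G x ε i).edgeSet)
    (hf : f ∈ (levelGraph G x ε j).edgeSet) (hef : e ≠ f) {v : V} (hve : v ∈ e) (hvf : v ∈ f) :
    𝔼 S ∈ admissibleChoices V ε d γ,
      (if e ∈ (outputGraph G x ε γ χ S).edgeSet then (1 : ℝ) else 0) *
        (if f ∈ (outputGraph G x ε γ χ S).edgeSet then (1 : ℝ) else 0) ≤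
      (numSampled γ ε d i / numColors γ ε i) * (numSampled γ ε d j / numColors γ ε j) := by
  have hne : ∀ k : Level V ε,
      (powersetCard (numSampled γ ε d k) (univ : Finset (Fin (numColors γ ε k)))).Nonempty := by
    intro k
    rw [powersetCard_nonempty, card_univ, Fintype.card_fin]
    exact numSampled_le _ _ _ _
  have hind : ∀ (k : Level V ε) (g : Sym2 V) (hg : g ∈ (levelGraph G x ε k).edgeSet) (S),
      (if g ∈ (outputGraph G x ε γ χ S).edgeSet then (1 : ℝ) else 0) =
        if χ k ⟨g, hg⟩ ∈ S k then 1 else 0 := fun k g hg S => by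
    simp only [mem_outputGraph_iff hε χ S k hg]
  simp_rw [hind i e he, hind j f hf]
  rw [admissibleChoices]
  by_cases hij : i = j
  · subst hij
    rw [expect_piFinset_apply _ hne i (fun T => (if χ i ⟨e, he⟩ ∈ T then (1 : ℝ) else 0) *
      (if χ i ⟨f, hf⟩ ∈ T then (1 : ℝ) else 0))]
    refine expect_powersetCard_mem_mul_mem_le (numSampled_le _ _ _ _) ?_
    refine (χ i).valid ?_
    -- Properness of the coloring enters here: edges of one level sharing `v` have distinct colors.
    rw [SimpleGraph.lineGraph_adj_iff_exists]
    exact ⟨fun h => hef (congrArg Subtype.val h), v, hve, hvf⟩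
  · rw [expect_piFinset_mul _ hne hij (fun T => if χ i ⟨e, he⟩ ∈ T then (1 : ℝ) else 0)
      (fun T => if χ j ⟨f, hf⟩ ∈ T then (1 : ℝ) else 0),
      expect_powersetCard_mem (numSampled_le _ _ _ _) (one_le_numSampled hε hd hγ _),
      expect_powersetCard_mem (numSampled_le _ _ _ _) (one_le_numSampled hε hd hγ _)]

/-- The variance bound for a reweighted edge indicator in round `i`. -/
theorem sq_div_sub_sq_le {ε d t : ℝ} {γ : ℕ} (hε : 0 < ε) (hd : 0 < d) (hγ : 1 ≤ γ) (i : ℕ)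
    (ht : 0 ≤ t) (hti : t ≤ (1 + ε) ^ (-(i : ℤ) + 1)) :
    t ^ 2 / ((numSampled γ ε d i : ℝ) / numColors γ ε i) - t ^ 2 ≤ 2 / d * t := by
  have hγ0 : (0 : ℝ) < γ := by exact_mod_cast hγ
  have hpow : (1 : ℝ) ≤ (1 + ε) ^ i := one_le_pow₀ (by linarith)
  have hM : ((⌈(1 + ε) ^ i⌉₊ : ℕ) : ℝ) ≤ 2 * (1 + ε) ^ i := by
    have := Nat.ceil_lt_add_one (by positivity : 0 ≤ (1 + ε) ^ i)
    linarith
  have hM0 : (0 : ℝ) < (⌈(1 + ε) ^ i⌉₊ : ℕ) := lt_of_lt_of_le (by positivity) (Nat.le_ceil _)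
  have hD : d * (1 + ε) ≤ (⌈d * (1 + ε)⌉₊ : ℕ) := Nat.le_ceil _
  have hD0 : (0 : ℝ) < (⌈d * (1 + ε)⌉₊ : ℕ) := lt_of_lt_of_le (by positivity) hD
  rw [numSampled, numColors]
  rcases le_total (γ * ⌈d * (1 + ε)⌉₊) (γ * ⌈(1 + ε) ^ i⌉₊) with h | h
  · rw [min_eq_left h]
    push_cast
    rw [mul_div_mul_left _ _ hγ0.ne']
    -- The 2 pays for rounding up the palette size; the factor `1 + ε` (the width of a level)
    -- cancels against the one in `⌈d * (1 + ε)⌉₊`.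
    have htM : t * (⌈(1 + ε) ^ i⌉₊ : ℕ) ≤ 2 * (1 + ε) := by
      rw [zpow_add₀ (by positivity), zpow_neg, zpow_natCast, zpow_one] at hti
      calc t * (⌈(1 + ε) ^ i⌉₊ : ℕ)
          ≤ (((1 + ε) ^ i)⁻¹ * (1 + ε)) * (2 * (1 + ε) ^ i) := by gcongr
        _ = 2 * (1 + ε) := by field_simp
    have hfrac : t * (⌈(1 + ε) ^ i⌉₊ : ℕ) / (⌈d * (1 + ε)⌉₊ : ℕ) ≤ 2 / d := by
      rw [div_le_div_iff₀ hD0 hd]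
      nlinarith
    have heq : t ^ 2 / ((⌈d * (1 + ε)⌉₊ : ℕ) / (⌈(1 + ε) ^ i⌉₊ : ℕ) : ℝ) =
        t * (⌈(1 + ε) ^ i⌉₊ : ℕ) / (⌈d * (1 + ε)⌉₊ : ℕ) * t := by
      field_simp
    rw [heq]
    have := mul_le_mul_of_nonneg_right hfrac ht
    nlinarith [sq_nonneg t]
  -- Here the whole palette is sampled, so the edge survives surely and the variance is zero.
  · rw [min_eq_right h, div_self (by
      push_cast
      positivity), div_one, sub_self]
    positivity

end Probabilities

/-! ### Discarded edges and the final accounting of losses. -/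

section Approximation

open Finset BigOperators

variable {V : Type*} [Fintype V]

theorem IsFractionalMatching.le_one {G : SimpleGraph V} {x : Sym2 V → ℝ}
    (hx : IsFractionalMatching G x) {e : Sym2 V} (he : e ∈ G.edgeSet) : x e ≤ 1 := by
  refine le_trans ?_ (hx.sum_le_one e.out.1)
  refine single_le_sum (f := x) (fun f hf => hx.nonneg f ?_) ?_
  · simpa using (mem_filter.1 hf).1
  · simp [he, Sym2.out_fst_mem]

/-- The edges that belong to one of the level graphs. -/
noncomputable def levelEdges (G : SimpleGraph V) (x : Sym2 V → ℝ) (ε : ℝ) : Finset (Sym2 V) :=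
  G.edgeFinset.filter fun e => ∃ i : Level V ε, e ∈ (levelGraph G x ε i).edgeSet

/-- Writing `n` for the number of vertices, each discarded edge has value at most `(ε/n)^2` and
there are at most `3/2 * n * μ(G)` edges. One factor `ε/n` cancels `n`; the other is at most `1/α`
because `α ≤ n/ε`. -/
theorem sum_levelEdges_ge {G : SimpleGraph V} {ε α : ℝ} (hε : 0 < ε) (hα : 0 < α)
    (hαn : α ≤ (Fintype.card V : ℝ) / ε) {x : Sym2 V → ℝ}
    (hx : IsApproxFractionalMatching G α x) :
    (1 - 3 / 2 * ε) * (matchingNumber G / α) ≤ ∑ e ∈ levelEdges G x ε, x e := by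
  have hn : (0 : ℝ) < Fintype.card V := by
    by_contra hcon
    have : (Fintype.card V : ℝ) / ε ≤ 0 := div_nonpos_of_nonpos_of_nonneg (not_lt.1 hcon) hε.le
    linarith
  have hV : 0 < Fintype.card V := by exact_mod_cast hn
  set low := G.edgeFinset.filter fun e => ¬ ∃ i : Level V ε, e ∈ (levelGraph G x ε i).edgeSet
  have hsplit : ∑ e ∈ levelEdges G x ε, x e + ∑ e ∈ low, x e = ∑ e ∈ G.edgeFinset, x e :=
    sum_filter_add_sum_filter_not _ _ _
  have hlow : ∑ e ∈ low, x e ≤ G.edgeFinset.card * (ε / Fintype.card V) ^ 2 := by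
    have h1 : ∑ e ∈ low, x e ≤ #low • (ε / Fintype.card V) ^ 2 := by
      refine sum_le_card_nsmul _ _ _ fun e he => ?_
      rw [mem_filter] at he
      have heG : e ∈ G.edgeSet := by simpa using he.1
      refine le_trans ?_ (zpow_neg_numLevels_le hε hV)
      by_contra hcon
      exact he.2 (exists_level hε heG (hx.le_one heG) (not_le.1 hcon))
    rw [nsmul_eq_mul] at h1
    refine h1.trans ?_
    gcongr
    exact filter_subset _ _
  have hinv : ε / Fintype.card V ≤ 1 / α := by
    rw [div_le_div_iff₀ hn hα]
    rw [le_div_iff₀ hε] at hαn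
    linarith
  have hbound : G.edgeFinset.card * (ε / Fintype.card V) ^ 2 ≤
      3 / 2 * ε * (matchingNumber G / α) := by
    calc G.edgeFinset.card * (ε / Fintype.card V) ^ 2
        ≤ (3 / 2 * (Fintype.card V * matchingNumber G)) * (ε / Fintype.card V) ^ 2 := by
          gcongr
          exact card_edgeFinset_le G
      _ = 3 / 2 * ε * matchingNumber G * (ε / Fintype.card V) := by field_simp
      _ ≤ 3 / 2 * ε * matchingNumber G * (1 / α) := by gcongr
      _ = _ := by ring
  have hval := hx.value_ge
  rw [one_div_mul_eq_div] at hval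
  linarith

theorem matchingNumber_le_expectedMatchingNumber {G : SimpleGraph V} {ε d α c : ℝ} {γ : ℕ}
    (hε0 : 0 < ε) (hd : 4 * Real.log (2 / ε) / ε ^ 2 ≤ d) (hγ : 1 ≤ γ)
    (hα : 0 < α) (hαn : α ≤ (Fintype.card V : ℝ) / ε) {x : Sym2 V → ℝ}
    (hx : IsApproxFractionalMatching G α x) (χ : LevelColorings G x ε γ)
    (hcov : ∀ S, ∃ w : V → ℝ, IsFractionalCover (outputGraph G x ε γ χ S) w ∧
      ∑ v, w v ≤ c * (matchingNumber (outputGraph G x ε γ χ S) : ℝ)) (hc : 0 < c) :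
    (1 - 6 * ε) / (c * α) * matchingNumber G ≤
      expectedMatchingNumber (sparsify G x ε d γ χ) := by
  rw [expectedMatchingNumber_sparsify]
  set Eμ := 𝔼 S ∈ admissibleChoices V ε d γ, (matchingNumber (outputGraph G x ε γ χ S) : ℝ)
  have hEμ : 0 ≤ Eμ := expect_nonneg fun _ _ => Nat.cast_nonneg _
  rcases le_or_gt (1 - 6 * ε) 0 with hneg | hpos
  · refine le_trans ?_ hEμ
    exact mul_nonpos_of_nonpos_of_nonneg (div_nonpos_of_nonpos_of_nonneg hneg (by positivity))
      (Nat.cast_nonneg _)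
  -- From `log t ≥ 1 - 1/t` at `t = 2/ε`: `d * ε^2 ≥ 4 - 2ε`, and `ε < 1/6` in this case.
  have hdε : 3 ≤ d * ε ^ 2 := by
    have hlog := Real.one_sub_inv_le_log_of_pos (by positivity : 0 < 2 / ε)
    rw [inv_div] at hlog
    rw [div_le_iff₀ (by positivity)] at hd
    linarith
  have hd0 : 0 < d := by
    by_contra hcon
    nlinarith [sq_nonneg ε]
  set E := levelEdges G x ε with hE
  have hEmem : ∀ e ∈ E, e ∈ G.edgeSet ∧ ∃ i : Level V ε, e ∈ (levelGraph G x ε i).edgeSet := by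
    intro e he
    rw [hE, levelEdges, mem_filter] at he
    exact ⟨by simpa using he.1, he.2⟩
  set p : Sym2 V → ℝ := fun e => 𝔼 S ∈ admissibleChoices V ε d γ,
      (if e ∈ (outputGraph G x ε γ χ S).edgeSet then (1 : ℝ) else 0) with hpdef
  have hp : ∀ (i : Level V ε) (e), e ∈ (levelGraph G x ε i).edgeSet →
      p e = numSampled γ ε d i / numColors γ ε i :=
    fun i e he => expect_mem_outputGraph hε0 hd0 hγ χ i he
  have hx0 : ∀ e ∈ E, 0 ≤ x e := fun e he => hx.nonneg e (hEmem e he).1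
  have hmain := sum_le_expect_matchingNumber (admissibleChoices_nonempty V ε d γ)
    (outputGraph G x ε γ χ) E x p (b := 2 / d) (c := c) hε0 hx0
    (fun v => le_trans (sum_le_sum_of_subset_of_nonneg
      (filter_subset_filter _ (filter_subset _ _))
      (fun e he _ => hx.nonneg e (by simpa using (mem_filter.1 he).1))) (hx.sum_le_one v))
    (fun e he => by
      obtain ⟨-, i, hi⟩ := hEmem e he
      rw [hp i e hi]
      have h1 : 0 < numSampled γ ε d i := one_le_numSampled hε0 hd0 hγ i
      have h2 : 0 < numColors γ ε i := h1.trans_le (numSampled_le _ _ _ _)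
      positivity)
    (fun e _ => rfl)
    (fun e he f hf hef v hve hvf => by
      obtain ⟨-, i, hi⟩ := hEmem e he
      obtain ⟨-, j, hj⟩ := hEmem f hf
      rw [hp i e hi, hp j f hj]
      exact expect_mem_mul_mem_outputGraph_le hε0 hd0 hγ χ i j hi hj hef hve hvf)
    (fun e he => by
      obtain ⟨-, i, hi⟩ := hEmem e he
      rw [hp i e hi]
      exact sq_div_sub_sq_le hε0 hd0 hγ i (hx0 e he) (mem_levelGraph_iff.1 hi).2.2)
    (fun S _ => hcov S) (by positivity)
  have hloss : 2 / d / (2 * ε) ≤ ε / 3 := by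
    rw [div_div, div_le_div_iff₀ (by positivity) (by norm_num)]
    nlinarith
  have hX := sum_levelEdges_ge hε0 hα hαn hx
  set X := ∑ e ∈ E, x e
  set m := (matchingNumber G : ℝ) / α with hm
  have hm0 : 0 ≤ m := by positivity
  have hX0 : 0 ≤ X := sum_nonneg hx0
  have h1 : (1 - ε / 3) * X ≤ (1 + ε) * (c * Eμ) :=
    (mul_le_mul_of_nonneg_right (by linarith) hX0).trans hmain
  have h2 : (1 - ε / 3) * ((1 - 3 / 2 * ε) * m) ≤ (1 + ε) * (c * Eμ) :=
    (mul_le_mul_of_nonneg_left hX (by linarith)).trans h1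
  -- The three losses are the slack `1 + ε` in the loads, the variance term `ε/3`, and the discarded
  -- edges `3/2 * ε`.
  have h3 : (1 + ε) * ((1 - 6 * ε) * m) ≤ (1 - ε / 3) * ((1 - 3 / 2 * ε) * m) := by
    rw [← mul_assoc, ← mul_assoc]
    exact mul_le_mul_of_nonneg_right (by nlinarith) hm0
  have h4 : (1 - 6 * ε) * m ≤ c * Eμ := le_of_mul_le_mul_left (h3.trans h2) (by linarith)
  have h5 : (1 - 6 * ε) / (c * α) * matchingNumber G = (1 - 6 * ε) * m / c := by
    rw [hm]
    field_simp
  rw [h5, div_le_iff₀ hc]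
  linarith

theorem le_of_mem_support_sparsify {G : SimpleGraph V} {x : Sym2 V → ℝ} {ε d : ℝ} {γ : ℕ}
    {χ : LevelColorings G x ε γ} {H : SimpleGraph V} (hH : H ∈ (sparsify G x ε d γ χ).support) :
    H ≤ G := by
  rw [sparsify, PMF.support_map] at hH
  obtain ⟨S, -, rfl⟩ := hH
  exact outputGraph_le G x ε γ χ S

end Approximation

end EdgeColorSparsify

open EdgeColorSparsify in
theorem mainTheorem8 {V : Type*} [Fintype V] (G : SimpleGraph V)
    (ε d α : ℝ) (γ : ℕ) (hε0 : 0 < ε) (hε : ε < 1 / 2)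
    (hd : 4 * Real.log (2 / ε) / ε ^ 2 ≤ d) (hγ : 1 ≤ γ)
    (hα : 0 < α) (hαn : α ≤ (Fintype.card V : ℝ) / ε)
    (x : Sym2 V → ℝ) (hx : IsApproxFractionalMatching G α x)
    (χ : LevelColorings G x ε γ) :
    (G.IsBipartite → HasApproxRatio G (sparsify G x ε d γ χ) (α / (1 - 6 * ε))) ∧
      HasApproxRatio G (sparsify G x ε d γ χ) (3 * α / (2 * (1 - 6 * ε))) := by
  refine ⟨fun hG => ⟨fun H hH => le_of_mem_support_sparsify hH, ?_⟩,
    fun H hH => le_of_mem_support_sparsify hH, ?_⟩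
  · have h := matchingNumber_le_expectedMatchingNumber hε0 hd hγ hα hαn hx χ
      (fun S => exists_fractionalCover_of_isBipartite
        (SimpleGraph.Colorable.mono_left (outputGraph_le G x ε γ χ S) hG)) one_pos
    rw [one_mul] at h
    rwa [one_div_div]
  · have h := matchingNumber_le_expectedMatchingNumber hε0 hd hγ hα hαn hx χ
      (fun S => exists_fractionalCover _) (by norm_num)
    have heq : 1 / (3 * α / (2 * (1 - 6 * ε))) = (1 - 6 * ε) / (3 / 2 * α) := by
      rw [one_div_div]
      field_simp
    rwa [heq]
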